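/- Let $R$ be a regular local ring, and let $t_1,\dots,t_r \in R$ be elements such that the ideal $I = (t_1,\dots,t_r)$ is a prime ideal of height $1$. Then $I$ is principal. Moreover, for every $t \in R$ with $I = (t)$ there exist an index $i \in \{1,\dots,r\}$ and a unit $u \in R$ such that $t_i = tu$. In particular, there exists an index $i$ with $I = (t_i)$. -/

import Mathlib

open CategoryTheory IsLocalRing

universe u

/-! The core is the Auslander–Buchsbaum theorem, `uniqueFactorizationMonoid`: a regular local ring
is factorial, so its height-one primes are principal. Once I = (s), some t_i is s times a unit, for
otherwise I ⊆ s𝔪, which is impossible for s ≠ 0 in a domain.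

Factoriality goes by induction on the embedding dimension. Choose x ∈ 𝔪 \ 𝔪²; it is a prime element,
so by Nagata's criterion it suffices that a height-one prime P of R_x is principal. Localizations of
R_x at maximal ideals are localizations of R at non-maximal primes, hence regular of smaller
dimension and factorial by induction; so P is locally principal, that is, projective. The
contraction of P to R has a finite free resolution, which makes P stably free, and a determinant
argument shows that a stably free ideal is principal.

That localizations stay regular is Serre's theorem: finite projective dimension of R/q passes to the
residue field of R_q, and this property characterizes regularity (`exists_projDimLE`,
`of_projDimLE_residueField`). -/

theorem IsLocalRing.isLocalRing_quotient_span_singleton {R : Type*} [CommRing R] [IsLocalRing R] {x : R}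
    (hx : x ∈ maximalIdeal R) :
    IsLocalRing (R ⧸ Ideal.span {x}) :=
  have : Nontrivial (R ⧸ Ideal.span {x}) := Ideal.Quotient.nontrivial_iff.mpr
    (fun h ↦ (Ideal.IsPrime.ne_top' (I := maximalIdeal R)) (top_le_iff.mp
      (h ▸ (Ideal.span_singleton_le_iff_mem _).mpr hx)))
  .of_surjective' _ Ideal.Quotient.mk_surjective

/-! ### Projective dimension and reduction modulo a regular element -/

namespace Module

/-- The `R`-module `M` has projective dimension at most `n`. -/
abbrev ProjDimLE (R : Type u) [CommRing R] (M : Type u) [AddCommGroup M] [Module R M] (n : ℕ) :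
    Prop :=
  HasProjectiveDimensionLE (ModuleCat.of R M) n

section

variable {R : Type u} [CommRing R] {M N : Type u} [AddCommGroup M] [Module R M]
  [AddCommGroup N] [Module R N]

theorem projDimLE_zero_iff : ProjDimLE R M 0 ↔ Module.Projective R M := by
  rw [ProjDimLE, ← projective_iff_hasProjectiveDimensionLE_zero, IsProjective.iff_projective]

theorem ProjDimLE.mono {m n : ℕ} (h : ProjDimLE R M m) (hmn : m ≤ n) : ProjDimLE R M n :=
  have : HasProjectiveDimensionLT (ModuleCat.of R M) (m + 1) := h
  hasProjectiveDimensionLT_of_ge _ (m + 1) (n + 1) (by lia)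

theorem ProjDimLE.of_equiv {n : ℕ} (h : ProjDimLE R M n) (e : M ≃ₗ[R] N) : ProjDimLE R N n :=
  have : HasProjectiveDimensionLT (ModuleCat.of R M) (n + 1) := h
  hasProjectiveDimensionLT_of_iso e.toModuleIso _

theorem ProjDimLE.of_retract {n : ℕ} (h : ProjDimLE R M n) (i : N →ₗ[R] M) (r : M →ₗ[R] N)
    (hri : r ∘ₗ i = LinearMap.id) : ProjDimLE R N n :=
  have : HasProjectiveDimensionLT (ModuleCat.of R M) (n + 1) := h
  Retract.hasProjectiveDimensionLT (Y := ModuleCat.of R M)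
    ⟨ModuleCat.ofHom i, ModuleCat.ofHom r, by rw [← ModuleCat.ofHom_comp, hri]; rfl⟩ _

theorem projDimLE_succ_iff_ker [Module.Projective R N] {f : N →ₗ[R] M}
    (hf : Function.Surjective f) (n : ℕ) :
    ProjDimLE R M (n + 1) ↔ ProjDimLE R (LinearMap.ker f) n := by
  have hS := LinearMap.shortExact_shortComplexKer hf
  have : CategoryTheory.Projective f.shortComplexKer.X₂ :=
    (IsProjective.iff_projective N).mp inferInstance
  exact hS.hasProjectiveDimensionLT_X₃_iff n this

/-- The reduction modulo an element regular on the quotient of the kernel of a surjection is the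
kernel of the reduction of that surjection. -/
theorem exists_quotSMulTop_ker_equiv {x : R} (hx : IsSMulRegular M x) {f : N →ₗ[R] M}
    (hf : Function.Surjective f) :
    ∃ g : QuotSMulTop x N →ₗ[R ⧸ Ideal.span {x}] QuotSMulTop x M, Function.Surjective g ∧
      Nonempty (QuotSMulTop x (LinearMap.ker f) ≃ₗ[R ⧸ Ideal.span {x}] LinearMap.ker g) := by
  let g := (QuotSMulTop.map x f).extendScalarsOfSurjective
    (Ideal.Quotient.mk_surjective (I := Ideal.span {x}))
  let i := (QuotSMulTop.map x (LinearMap.ker f).subtype).extendScalarsOfSurjective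
    (Ideal.Quotient.mk_surjective (I := Ideal.span {x}))
  have hg : Function.Surjective g := QuotSMulTop.map_surjective x hf
  have hex : Function.Exact i g := QuotSMulTop.map_exact x
    (LinearMap.exact_subtype_ker_map f) hf
  -- This is the vanishing of Tor₁(M, R/x): if xb lies in the kernel, regularity on M puts b there
  -- too.
  have hi : Function.Injective i := by
    rw [injective_iff_map_eq_zero]
    intro a ha
    obtain ⟨a, rfl⟩ := Submodule.Quotient.mk_surjective _ a
    have h1 : QuotSMulTop.map x (LinearMap.ker f).subtype (Submodule.Quotient.mk a) = 0 := ha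
    rw [QuotSMulTop.map_apply_mk, Submodule.Quotient.mk_eq_zero,
      Submodule.mem_smul_pointwise_iff_exists] at h1
    obtain ⟨b, -, hb⟩ := h1
    rw [Submodule.Quotient.mk_eq_zero, Submodule.mem_smul_pointwise_iff_exists]
    refine ⟨⟨b, ?_⟩, trivial, Subtype.ext hb⟩
    have h2 : f (x • b) = 0 := by rw [hb]; exact a.2
    rw [map_smul] at h2
    exact hx.right_eq_zero_of_smul h2
  refine ⟨g, hg, ⟨(LinearEquiv.ofInjective i hi).trans (LinearEquiv.ofEq _ _ ?_)⟩⟩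
  exact (LinearMap.exact_iff.mp hex).symm

theorem isSMulRegular_ker {x : R} (hx : IsSMulRegular N x) (f : N →ₗ[R] M) :
    IsSMulRegular (LinearMap.ker f) x :=
  hx.of_injective (LinearMap.ker f).subtype Subtype.val_injective

theorem projective_quotSMulTop [Module.Projective R M] (x : R) :
    Module.Projective (R ⧸ Ideal.span {x}) (QuotSMulTop x M) :=
  Module.Projective.of_equiv ((QuotSMulTop.equivQuotTensor x M).extendScalarsOfSurjective
    Ideal.Quotient.mk_surjective).symm

/-- Induction on syzygies: presentations stay exact modulo x, and the syzygy, inside a free module,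
is again x-regular. -/
theorem ProjDimLE.quotSMulTop {x : R} (hxR : IsSMulRegular R x) {n : ℕ} (h : ProjDimLE R M n)
    (hx : IsSMulRegular M x) : ProjDimLE (R ⧸ Ideal.span {x}) (QuotSMulTop x M) n := by
  induction n generalizing M with
  | zero =>
    rw [projDimLE_zero_iff] at h ⊢
    exact projective_quotSMulTop x
  | succ n ih =>
    have hf : Function.Surjective (Finsupp.linearCombination R (id : M → M)) :=
      Finsupp.linearCombination_id_surjective R M
    rw [projDimLE_succ_iff_ker hf] at h
    obtain ⟨g, hg, ⟨e⟩⟩ := exists_quotSMulTop_ker_equiv hx hf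
    have := projective_quotSMulTop (R := R) (M := M →₀ R) x
    rw [projDimLE_succ_iff_ker hg]
    exact (ih h (isSMulRegular_ker (hxR.finsupp) _)).of_equiv e

/-- The same syzygy induction; at the bottom, freeness of M/xM lifts to M. -/
theorem ProjDimLE.of_quotSMulTop [IsLocalRing R] [IsNoetherianRing R] {x : R}
    (hxm : x ∈ maximalIdeal R)
    (hxR : IsSMulRegular R x) {n : ℕ} [Module.Finite R M]
    (h : ProjDimLE (R ⧸ Ideal.span {x}) (QuotSMulTop x M) n)
    (hx : IsSMulRegular M x) : ProjDimLE R M n := by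
  have := IsLocalRing.isLocalRing_quotient_span_singleton hxm
  induction n generalizing M with
  | zero =>
    rw [projDimLE_zero_iff] at h ⊢
    have := Module.Finite.of_restrictScalars_finite R (R ⧸ Ideal.span {x}) (QuotSMulTop x M)
    have : Module.Free (R ⧸ Ideal.span {x}) (QuotSMulTop x M) := Module.free_of_flat_of_isLocalRing
    have hp := Module.finitePresentation_of_finite R M
    have := (Module.free_quotSMulTop_iff_free R M
      (by rwa [IsLocalRing.jacobson_eq_maximalIdeal _ bot_ne_top]) hx).mp ‹_›
    infer_instance
  | succ n ih =>
    obtain ⟨m, f, hf⟩ := Module.Finite.exists_fin' R M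
    obtain ⟨g, hg, ⟨e⟩⟩ := exists_quotSMulTop_ker_equiv hx hf
    have := projective_quotSMulTop (R := R) (M := Fin m → R) x
    rw [projDimLE_succ_iff_ker hg] at h
    rw [projDimLE_succ_iff_ker hf]
    exact ih (h.of_equiv e.symm) (isSMulRegular_ker (.pi fun _ ↦ hxR) _)

end

end Module

/-! ### Embedding dimension and prime avoidance -/

namespace IsLocalRing

section

variable {R : Type*} [CommRing R] [IsLocalRing R]

theorem maximalIdeal_quotient_eq_map (I : Ideal R) [IsLocalRing (R ⧸ I)] :
    maximalIdeal (R ⧸ I) = (maximalIdeal R).map (Ideal.Quotient.mk I) := by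
  have h := IsLocalRing.eq_maximalIdeal (Ideal.comap_isMaximal_of_surjective (Ideal.Quotient.mk I)
    Ideal.Quotient.mk_surjective (K := maximalIdeal (R ⧸ I)))
  rw [← h, Ideal.map_comap_of_surjective _ Ideal.Quotient.mk_surjective]

variable [IsNoetherianRing R]

/-- An element of the maximal ideal outside its square is part of a minimal generating set. -/
theorem spanFinrank_maximalIdeal_quotient_add_one_le {x : R} (hx : x ∈ maximalIdeal R)
    (hx2 : x ∉ maximalIdeal R ^ 2) [IsLocalRing (R ⧸ Ideal.span {x})] :
    (maximalIdeal (R ⧸ Ideal.span {x})).spanFinrank + 1 ≤ (maximalIdeal R).spanFinrank := by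
  classical
  obtain ⟨s, hcard, hs⟩ := Submodule.FG.exists_span_finset_card_eq_spanFinrank
    (maximalIdeal R).fg_of_isNoetherianRing
  have hsm : ∀ g ∈ s, g ∈ maximalIdeal R := fun g hg ↦ hs ▸ Submodule.subset_span hg
  obtain ⟨f, -, hf⟩ := Submodule.mem_span_finset.mp (hs.symm ▸ hx : x ∈ Submodule.span R (s : Set R))
  -- If all coefficients of x were in 𝔪, then x would be in 𝔪². The generator g becomes redundant
  -- modulo x.
  obtain ⟨g, hg, hfg⟩ : ∃ g ∈ s, IsUnit (f g) := by
    by_contra! h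
    refine hx2 (hf ▸ Ideal.sum_mem _ fun g hg ↦ ?_)
    rw [pow_two]
    exact Ideal.mul_mem_mul (h g hg) (hsm g hg)
  have hle : maximalIdeal (R ⧸ Ideal.span {x}) =
      Ideal.span ((s.erase g).image (Ideal.Quotient.mk (Ideal.span {x})) : Set _) := by
    refine le_antisymm ?_ ?_
    · rw [maximalIdeal_quotient_eq_map, ← hs]
      change Ideal.map _ (Ideal.span _) ≤ _
      rw [Ideal.map_span, Ideal.span_le]
      have hother : ∀ a ∈ s.erase g, Ideal.Quotient.mk (Ideal.span {x}) a ∈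
          Ideal.span ((s.erase g).image (Ideal.Quotient.mk (Ideal.span {x})) : Set _) :=
        fun a ha ↦ Ideal.subset_span (by simpa using ⟨a, by simpa [and_comm] using ha, rfl⟩)
      rintro _ ⟨a, ha, rfl⟩
      by_cases hag : a = g
      · subst hag
        rw [← Finset.add_sum_erase s _ hg] at hf
        have h0 := congrArg (Ideal.Quotient.mk (Ideal.span {x})) hf
        rw [Ideal.Quotient.mk_singleton_self, map_add, smul_eq_mul, map_mul, map_sum] at h0
        have h1 := eq_neg_of_add_eq_zero_left h0
        refine (Ideal.unit_mul_mem_iff_mem _ (hfg.map (Ideal.Quotient.mk (Ideal.span {x})))).mp ?_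
        rw [h1]
        refine neg_mem (Ideal.sum_mem _ fun i hi ↦ ?_)
        rw [smul_eq_mul, map_mul]
        exact Ideal.mul_mem_left _ _ (hother i hi)
      · exact hother a (Finset.mem_erase.mpr ⟨hag, ha⟩)
    · rw [Ideal.span_le, maximalIdeal_quotient_eq_map]
      intro b hb
      obtain ⟨a, ha, rfl⟩ := Finset.mem_image.mp (Finset.mem_coe.mp hb)
      exact Ideal.mem_map_of_mem _ (hsm a (Finset.mem_of_mem_erase ha))
  have h1 : (maximalIdeal (R ⧸ Ideal.span {x})).spanFinrank ≤ (s.erase g).card := by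
    rw [hle]
    refine (Submodule.spanFinrank_span_le_ncard_of_finite (Finset.finite_toSet _)).trans ?_
    rw [Set.ncard_coe_finset]
    exact Finset.card_image_le
  rw [← hcard, ← Finset.card_erase_add_one hg]
  lia

theorem spanFinrank_maximalIdeal_le_quotient_add_one {x : R} (hx : x ∈ maximalIdeal R)
    [IsLocalRing (R ⧸ Ideal.span {x})] :
    (maximalIdeal R).spanFinrank ≤ (maximalIdeal (R ⧸ Ideal.span {x})).spanFinrank + 1 := by
  classical
  obtain ⟨s, hcard, hs⟩ := Submodule.FG.exists_span_finset_card_eq_spanFinrank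
    (maximalIdeal (R ⧸ Ideal.span {x})).fg_of_isNoetherianRing
  obtain ⟨l, hl⟩ := (Ideal.Quotient.mk_surjective (I := Ideal.span {x})).hasRightInverse
  have hle : maximalIdeal R = Ideal.span ((insert x (s.image l) : Finset R) : Set R) := by
    have hmap : Ideal.map (Ideal.Quotient.mk (Ideal.span {x})) (maximalIdeal R) =
        Ideal.map (Ideal.Quotient.mk (Ideal.span {x}))
          (Ideal.span ((insert x (s.image l) : Finset R) : Set R)) := by
      rw [← maximalIdeal_quotient_eq_map, ← hs, Ideal.map_span]
      change Ideal.span _ = _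
      rw [Finset.coe_insert, Set.image_insert_eq, Ideal.Quotient.mk_singleton_self,
        Finset.coe_image, Set.image_image]
      simp [hl _, Ideal.span_insert]
    have h2 := congrArg (Ideal.comap (Ideal.Quotient.mk (Ideal.span {x}))) hmap
    rw [Ideal.comap_map_of_surjective' _ Ideal.Quotient.mk_surjective,
      Ideal.comap_map_of_surjective' _ Ideal.Quotient.mk_surjective, Ideal.mk_ker,
      sup_eq_left.mpr ((Ideal.span_singleton_le_iff_mem _).mpr hx), sup_eq_left.mpr] at h2
    · exact h2
    · exact Ideal.span_mono (by simp)
  rw [hle, ← hcard]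
  refine (Submodule.spanFinrank_span_le_ncard_of_finite (Finset.finite_toSet _)).trans ?_
  rw [Set.ncard_coe_finset]
  exact (Finset.card_insert_le _ _).trans (by grind [Finset.card_image_le])

theorem maximalIdeal_le_sq_iff : maximalIdeal R ≤ maximalIdeal R ^ 2 ↔ maximalIdeal R = ⊥ := by
  refine ⟨fun h ↦ ?_, fun h ↦ by simp [h]⟩
  refine Submodule.eq_bot_of_le_smul_of_le_jacobson_bot (maximalIdeal R) _
    (maximalIdeal R).fg_of_isNoetherianRing ?_ ?_
  · rwa [smul_eq_mul, ← pow_two]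
  · rw [IsLocalRing.jacobson_eq_maximalIdeal _ bot_ne_top]

/-- If the maximal ideal is neither zero nor contained in one of finitely many primes, then it has
an element avoiding its square and these primes. -/
theorem exists_mem_maximalIdeal_notMem_sq (hm : maximalIdeal R ≠ ⊥) {S : Set (Ideal R)}
    (hS : S.Finite) (hprime : ∀ P ∈ S, P.IsPrime) (hle : ∀ P ∈ S, ¬ maximalIdeal R ≤ P) :
    ∃ x ∈ maximalIdeal R, x ∉ maximalIdeal R ^ 2 ∧ ∀ P ∈ S, x ∉ P := by
  by_contra! h
  -- Prime avoidance tolerates two non-prime ideals; both exceptional slots are filled with 𝔪².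
  have h1 := (Ideal.subset_union_prime_finite (f := id) (I := maximalIdeal R)
    (hS.insert (maximalIdeal R ^ 2)) (maximalIdeal R ^ 2) (maximalIdeal R ^ 2)
    (fun P hP h1 _ ↦ hprime P (hP.resolve_left h1))).mp (by
      intro x hx
      by_cases h2 : x ∈ maximalIdeal R ^ 2
      · exact Set.mem_biUnion (Set.mem_insert _ _) h2
      · obtain ⟨P, hP, hxP⟩ := h x hx h2
        exact Set.mem_biUnion (Set.mem_insert_of_mem _ hP) hxP)
  obtain ⟨P, rfl | hP, hmP⟩ := h1
  · exact hm (maximalIdeal_le_sq_iff.mp hmP)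
  · exact hle P hP hmP

theorem exists_mem_maximalIdeal_notMem_sq' (hm : maximalIdeal R ≠ ⊥) :
    ∃ x ∈ maximalIdeal R, x ∉ maximalIdeal R ^ 2 := by
  simpa using exists_mem_maximalIdeal_notMem_sq hm Set.finite_empty (by simp) (by simp)

end

end IsLocalRing

/-! ### Regular local rings: quotients, integrality, finite projective dimension -/

namespace IsRegularLocalRing

/-- The Krull dimension drops by at most one, the embedding dimension by at least one. -/
theorem quotient_span_singleton {R : Type*} [CommRing R] [IsRegularLocalRing R] {x : R}
    (hx : x ∈ maximalIdeal R)
    (hx2 : x ∉ maximalIdeal R ^ 2) : IsRegularLocalRing (R ⧸ Ideal.span {x}) := by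
  have := isLocalRing_quotient_span_singleton hx
  refine .of_spanFinrank_maximalIdeal_le _ ?_
  have h1 := ringKrullDim_le_ringKrullDim_quotSMulTop_succ hx
  rw [← Submodule.ideal_span_singleton_smul, smul_eq_mul, Ideal.mul_top,
    ← IsRegularLocalRing.spanFinrank_maximalIdeal] at h1
  have h2 := spanFinrank_maximalIdeal_quotient_add_one_le hx hx2
  have h3 : (((maximalIdeal (R ⧸ Ideal.span {x})).spanFinrank : WithBot ℕ∞) + 1) ≤
    ringKrullDim (R ⧸ Ideal.span {x}) + 1 := le_trans (by exact_mod_cast h2) h1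
  exact (ENat.WithBot.add_le_add_one_right_iff).mp h3

theorem of_quotient_span_singleton {R : Type*} [CommRing R] [IsLocalRing R] [IsNoetherianRing R]
    {x : R} (hx : x ∈ maximalIdeal R) (hreg : IsSMulRegular R x)
    [IsRegularLocalRing (R ⧸ Ideal.span {x})] : IsRegularLocalRing R := by
  refine .of_spanFinrank_maximalIdeal_le _ ?_
  rw [← ringKrullDim_quotient_span_singleton_succ_eq_ringKrullDim_of_mem_jacobson hreg
    (by rwa [IsLocalRing.ringJacobson_eq_maximalIdeal]),
    ← IsRegularLocalRing.spanFinrank_maximalIdeal]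
  exact_mod_cast spanFinrank_maximalIdeal_le_quotient_add_one hx

theorem isDomain {R : Type*} [CommRing R] [IsRegularLocalRing R] : IsDomain R := by
  induction hn : (maximalIdeal R).spanFinrank using Nat.strong_induction_on generalizing R with
  | h n ih =>
  by_cases hm : maximalIdeal R = ⊥
  · exact (IsLocalRing.isField_iff_maximalIdeal_eq.mpr hm).isDomain
  have hnot : ∀ P ∈ minimalPrimes R, ¬ maximalIdeal R ≤ P := by
    intro P hP hle
    have hprime : P.IsPrime := hP.1.1
    have hPm : P = maximalIdeal R := (IsLocalRing.le_maximalIdeal hprime.ne_top).antisymm hle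
    have h0 : (maximalIdeal R).height = 0 := by
      rwa [← hPm, Ideal.height_eq_zero_iff]
    have h1 := IsRegularLocalRing.spanFinrank_maximalIdeal (R := R)
    rw [← IsLocalRing.maximalIdeal_height_eq_ringKrullDim, h0] at h1
    exact hm ((Submodule.spanFinrank_eq_zero_iff_eq_bot
      (maximalIdeal R).fg_of_isNoetherianRing).mp (by exact_mod_cast h1))
  obtain ⟨x, hx, hx2, hxP⟩ := exists_mem_maximalIdeal_notMem_sq hm
    (minimalPrimes.finite_of_isNoetherianRing R) (fun P hP ↦ hP.1.1) hnot
  have := quotient_span_singleton hx hx2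
  have hdom := ih _ (by
    have := spanFinrank_maximalIdeal_quotient_add_one_le hx hx2
    lia) (R := R ⧸ Ideal.span {x}) rfl
  have hprime : (Ideal.span {x}).IsPrime := (Ideal.Quotient.isDomain_iff_prime _).mp hdom
  obtain ⟨P, hP, hPx⟩ := Ideal.exists_minimalPrimes_le (bot_le (a := Ideal.span {x}))
  have hPprime : P.IsPrime := hP.1.1
  -- P ⊆ (x) and x ∉ P give P = xP; then Nakayama applies.
  have hPbot : P = ⊥ := by
    refine Submodule.eq_bot_of_le_smul_of_le_jacobson_bot (Ideal.span {x}) _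
      P.fg_of_isNoetherianRing ?_ ?_
    · intro y hy
      obtain ⟨z, rfl⟩ := Ideal.mem_span_singleton.mp (hPx hy)
      exact Ideal.mul_mem_mul (Ideal.mem_span_singleton_self x)
        ((hPprime.mem_or_mem hy).resolve_left (hxP P hP))
    · rw [IsLocalRing.jacobson_eq_maximalIdeal _ bot_ne_top]
      exact (Ideal.span_singleton_le_iff_mem _).mpr hx
  subst hPbot
  exact IsDomain.of_bot_isPrime R

/-- Finitely generated modules over a regular local ring have finite projective dimension. -/
theorem exists_projDimLE {R : Type u} [CommRing R] [IsRegularLocalRing R] (M : Type u)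
    [AddCommGroup M] [Module R M] [Module.Finite R M] : ∃ n, Module.ProjDimLE R M n := by
  induction hn : (maximalIdeal R).spanFinrank using Nat.strong_induction_on generalizing R M with
  | h n ih =>
  by_cases hm : maximalIdeal R = ⊥
  · let := (IsLocalRing.isField_iff_maximalIdeal_eq.mpr hm).toField
    exact ⟨0, Module.projDimLE_zero_iff.mpr inferInstance⟩
  have := isDomain (R := R)
  obtain ⟨x, hx, hx2⟩ := exists_mem_maximalIdeal_notMem_sq' hm
  have hxR : IsSMulRegular R x :=
    (IsRegular.of_ne_zero (by rintro rfl; exact hx2 (zero_mem _))).left.isSMulRegular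
  have := quotient_span_singleton hx hx2
  -- M may have x-torsion, so the induction hypothesis is applied to its first syzygy, on which x is
  -- regular.
  obtain ⟨m, f, hf⟩ := Module.Finite.exists_fin' R M
  have := Module.Finite.of_restrictScalars_finite R (R ⧸ Ideal.span {x})
    (QuotSMulTop x (LinearMap.ker f))
  obtain ⟨k, hk⟩ := ih _ (by
    have := spanFinrank_maximalIdeal_quotient_add_one_le hx hx2
    lia) (R := R ⧸ Ideal.span {x}) (QuotSMulTop x (LinearMap.ker f)) rfl
  exact ⟨k + 1, (Module.projDimLE_succ_iff_ker hf k).mpr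
    (hk.of_quotSMulTop hx hxR (Module.isSMulRegular_ker (.pi fun _ ↦ hxR) f))⟩

end IsRegularLocalRing

/-! ### Finite projective dimension of the residue field forces regularity -/

theorem Module.annihilator_eq_bot_of_free (R M : Type*) [CommRing R] [AddCommGroup M] [Module R M]
    [Module.Free R M] [Nontrivial M] : Module.annihilator R M = ⊥ :=
  Module.annihilator_eq_bot.mpr inferInstance

open TensorProduct in
/-- Over a local ring with a nonzero element killed by the maximal ideal, finitely generated modules
of finite projective dimension are free. -/
theorem Module.free_of_projDimLE_of_socle_ne_zero {R : Type u} [CommRing R] [IsLocalRing R]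
    [IsNoetherianRing R]
    {s : R} (hs : s ≠ 0) (hsm : ∀ a ∈ maximalIdeal R, a * s = 0) {M : Type u} [AddCommGroup M]
    [Module R M] [Module.Finite R M] {n : ℕ} (h : ProjDimLE R M n) : Module.Free R M := by
  induction n generalizing M with
  | zero =>
    rw [projDimLE_zero_iff] at h
    exact Module.free_of_flat_of_isLocalRing
  | succ n ih =>
    obtain ⟨m, f, hf⟩ := Module.Finite.exists_fin' R M
    have hK := ih ((projDimLE_succ_iff_ker hf n).mp h)
    refine Module.free_of_lTensor_residueField_injective (LinearMap.ker f).subtype f hf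
      (LinearMap.exact_subtype_ker_map f) ?_
    rw [injective_iff_map_eq_zero]
    intro a ha
    obtain ⟨e, rfl⟩ := TensorProduct.mk_surjective R (LinearMap.ker f) (ResidueField R)
      IsLocalRing.residue_surjective a
    have hcoord : ∀ i, (e : Fin m → R) i ∈ maximalIdeal R := by
      intro i
      have h1 := congrArg (TensorProduct.rid R (ResidueField R))
        (congrArg (LinearMap.lTensor (ResidueField R) (LinearMap.proj (φ := fun _ ↦ R) i)) ha)
      rw [← IsLocalRing.residue_eq_zero_iff]
      simpa [Algebra.smul_def] using h1
    -- A syzygy with coordinates in 𝔪 is killed by s, so its coordinates in a basis of the free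
    -- kernel are non-units: it vanishes modulo 𝔪.
    have hse : s • e = 0 := by
      ext i
      simpa [mul_comm] using hsm _ (hcoord i)
    let b := Module.Free.chooseBasis R (LinearMap.ker f)
    have hb : ∀ i, b.repr e i ∈ maximalIdeal R := by
      intro i hu
      have h1 : s * b.repr e i = 0 := by
        simpa using congrArg (fun v ↦ b.repr v i) hse
      exact hs (hu.mul_left_eq_zero.mp h1)
    change (1 : ResidueField R) ⊗ₜ[R] e = 0
    rw [← b.sum_repr e, TensorProduct.tmul_sum]
    refine Finset.sum_eq_zero fun i _ ↦ ?_
    rw [← TensorProduct.smul_tmul, Algebra.smul_def, mul_one]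
    change residue R _ ⊗ₜ[R] _ = _
    rw [(IsLocalRing.residue_eq_zero_iff _).mpr (hb i), TensorProduct.zero_tmul]

namespace IsLocalRing

theorem maximalIdeal_eq_bot_of_free_residueField {R : Type*} [CommRing R] [IsLocalRing R]
    [Module.Free R (ResidueField R)] : maximalIdeal R = ⊥ := by
  rw [eq_bot_iff, ← Module.annihilator_eq_bot_of_free R (ResidueField R)]
  intro a ha
  rw [Module.mem_annihilator]
  intro c
  rw [Algebra.smul_def]
  change residue R a * c = 0
  rw [(residue_eq_zero_iff a).mpr ha, zero_mul]

theorem exists_linearMap_residueField_eq_one {R : Type*} [CommRing R] [IsLocalRing R]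
    {x : R} (hx : x ∈ maximalIdeal R) (hx2 : x ∉ maximalIdeal R ^ 2) :
    ∃ φ : maximalIdeal R →ₗ[R] ResidueField R, φ ⟨x, hx⟩ = 1 := by
  have hne : (maximalIdeal R).toCotangent ⟨x, hx⟩ ≠ 0 :=
    fun h ↦ hx2 ((Ideal.toCotangent_eq_zero _ _).mp h)
  obtain ⟨g, hg⟩ := Module.Projective.exists_dual_eq_one (ResidueField R) (V := CotangentSpace R) hne
  exact ⟨(g.restrictScalars R) ∘ₗ (maximalIdeal R).toCotangent, hg⟩

/-- For `x` in the maximal ideal `𝔪` but not in its square, the residue field of `R ⧸ (x)` is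
a direct summand of `𝔪 ⧸ x𝔪`. -/
theorem exists_retract_residueField_quotSMulTop {R : Type*} [CommRing R] [IsLocalRing R]
    {x : R} (hx : x ∈ maximalIdeal R) (hx2 : x ∉ maximalIdeal R ^ 2)
    [IsLocalRing (R ⧸ Ideal.span {x})] :
    ∃ (i : ResidueField (R ⧸ Ideal.span {x}) →ₗ[R ⧸ Ideal.span {x}]
        QuotSMulTop x (maximalIdeal R))
      (r : QuotSMulTop x (maximalIdeal R) →ₗ[R ⧸ Ideal.span {x}]
        ResidueField (R ⧸ Ideal.span {x})), r ∘ₗ i = LinearMap.id := by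
  obtain ⟨φ, hφ⟩ := exists_linearMap_residueField_eq_one hx hx2
  let k' := ResidueField (R ⧸ Ideal.span {x})
  let A := R ⧸ Ideal.span {x}
  have hkill : ∀ a ∈ maximalIdeal R, algebraMap R k' a = 0 := by
    intro a ha
    change residue A (Ideal.Quotient.mk _ a) = 0
    rw [residue_eq_zero_iff, maximalIdeal_quotient_eq_map]
    exact Ideal.mem_map_of_mem _ ha
  let ψ : ResidueField R →ₗ[R] k' := Submodule.liftQ (maximalIdeal R) (Algebra.linearMap R k')
    (fun a ha ↦ hkill a ha)
  have hψ : ψ 1 = 1 := (algebraMap R k').map_one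
  let r : QuotSMulTop x (maximalIdeal R) →ₗ[A] k' :=
    (Submodule.liftQ _ (ψ ∘ₗ φ) (by
      intro y hy
      obtain ⟨z, -, rfl⟩ := (Submodule.mem_smul_pointwise_iff_exists _ _ _).mp hy
      rw [LinearMap.mem_ker, map_smul, Algebra.smul_def, hkill x hx, zero_mul])
      ).extendScalarsOfSurjective Ideal.Quotient.mk_surjective
  -- The map 1 ↦ x is well defined because ax ∈ x𝔪 for a ∈ 𝔪.
  let i : k' →ₗ[A] QuotSMulTop x (maximalIdeal R) := Submodule.liftQ (maximalIdeal A)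
    (LinearMap.toSpanSingleton A _ (Submodule.Quotient.mk ⟨x, hx⟩)) (by
      intro y hy
      rw [maximalIdeal_quotient_eq_map] at hy
      obtain ⟨a, ha, rfl⟩ := (Ideal.mem_map_iff_of_surjective _ Ideal.Quotient.mk_surjective).mp hy
      change (Submodule.Quotient.mk (a • (⟨x, hx⟩ : maximalIdeal R)) :
        QuotSMulTop x (maximalIdeal R)) = 0
      rw [Submodule.Quotient.mk_eq_zero, Submodule.mem_smul_pointwise_iff_exists]
      exact ⟨⟨a, ha⟩, trivial, Subtype.ext (mul_comm x a)⟩)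
  refine ⟨i, r, LinearMap.ext fun c ↦ ?_⟩
  obtain ⟨a, rfl⟩ := IsLocalRing.residue_surjective c
  have hr1 : r (i 1) = 1 := by
    have : i 1 = Submodule.Quotient.mk ⟨x, hx⟩ :=
      one_smul A (Submodule.Quotient.mk ⟨x, hx⟩ : QuotSMulTop x (maximalIdeal R))
    rw [this]
    change ψ (φ ⟨x, hx⟩) = 1
    rw [hφ, hψ]
  have : residue A a = a • (1 : k') := by rw [Algebra.smul_def, mul_one]; rfl
  rw [this, map_smul, LinearMap.comp_apply, hr1, LinearMap.id_apply]

end IsLocalRing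

/-- A Noetherian local ring whose residue field has finite projective dimension is regular. -/
theorem IsRegularLocalRing.of_projDimLE_residueField {R : Type u} [CommRing R] [IsLocalRing R]
    [IsNoetherianRing R] {n : ℕ} (h : Module.ProjDimLE R (ResidueField R) n) :
    IsRegularLocalRing R := by
  induction hd : (maximalIdeal R).spanFinrank using Nat.strong_induction_on generalizing R with
  | h d ih =>
  by_cases hm : maximalIdeal R = ⊥
  · refine .of_spanFinrank_maximalIdeal_le _ ?_
    rw [hm, Submodule.spanFinrank_bot]
    exact ringKrullDim_nonneg_of_nontrivial
  -- Positive depth permits a regular x outside 𝔪² and induction. In depth zero the residue field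
  -- would be free, which forces 𝔪 = 0.
  by_cases hass : ∀ P ∈ associatedPrimes R R, ¬ maximalIdeal R ≤ P
  · obtain ⟨x, hx, hx2, hxP⟩ := exists_mem_maximalIdeal_notMem_sq hm
      (associatedPrimes.finite R R) (fun P hP ↦ hP.isPrime) hass
    have hxR : IsSMulRegular R x := by
      have h1 : x ∈ nonZeroDivisors R := by
        by_contra h1
        have h2 : x ∈ ((nonZeroDivisors R : Set R)ᶜ) := h1
        rw [← biUnion_associatedPrimes_eq_compl_nonZeroDivisors] at h2
        obtain ⟨P, hP, hxP'⟩ := Set.mem_iUnion₂.mp h2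
        exact hxP P hP hxP'
      exact (isRegular_iff_mem_nonZeroDivisors.mpr h1).left.isSMulRegular
    have hloc := isLocalRing_quotient_span_singleton hx
    have hker : LinearMap.ker (Algebra.linearMap R (ResidueField R)) = maximalIdeal R :=
      Submodule.ext fun a ↦ residue_eq_zero_iff a
    have h1 : Module.ProjDimLE R (maximalIdeal R) n :=
      ((Module.projDimLE_succ_iff_ker (f := Algebra.linearMap R (ResidueField R))
        residue_surjective n).mp (h.mono n.le_succ)).of_equiv (LinearEquiv.ofEq _ _ hker)
    have h2 := h1.quotSMulTop hxR
      (hxR.of_injective (maximalIdeal R).subtype Subtype.val_injective)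
    obtain ⟨i, r, hir⟩ := exists_retract_residueField_quotSMulTop hx hx2
    have := ih _ (by
      have := spanFinrank_maximalIdeal_quotient_add_one_le hx hx2
      lia) (R := R ⧸ Ideal.span {x}) (h2.of_retract i r hir) rfl
    exact .of_quotient_span_singleton hx hxR
  · push Not at hass
    obtain ⟨P, hP, hle⟩ := hass
    have hPm := (IsLocalRing.le_maximalIdeal hP.isPrime.ne_top).antisymm hle
    obtain ⟨-, s, hs⟩ := isAssociatedPrime_iff.mp hP
    have hs0 : s ≠ 0 := by
      rintro rfl
      apply hP.isPrime.ne_top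
      rw [hs]
      simp
    have hfree := Module.free_of_projDimLE_of_socle_ne_zero hs0 (fun a ha ↦ by
      rw [← hPm, hs, Submodule.mem_colon_singleton] at ha
      simpa using ha) h
    exact absurd maximalIdeal_eq_bot_of_free_residueField hm

/-! ### Localization of regular local rings -/

theorem Module.ProjDimLE.localizedModule {R : Type u} [CommRing R] {M : Type u} [AddCommGroup M]
    [Module R M] {n : ℕ} (h : ProjDimLE R M n) (S : Submonoid R) :
    ProjDimLE (Localization S) (LocalizedModule S M) n := by
  have : HasProjectiveDimensionLE (ModuleCat.of R M) n := h
  have h1 := ModuleCat.localizedModule_hasProjectiveDimensionLE n S (ModuleCat.of R M)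
  exact ProjDimLE.of_equiv (M := Shrink.{u} (LocalizedModule S M)) h1
    (Shrink.linearEquiv (Localization S) (LocalizedModule S M))

/-- The localization of `R ⧸ q` at a prime ideal `q` is the residue field of `q`. -/
theorem nonempty_localizedModule_quotient_equiv_residueField {R : Type*} [CommRing R] (q : Ideal R)
    [q.IsPrime] : Nonempty (LocalizedModule q.primeCompl (R ⧸ q) ≃ₗ[Localization.AtPrime q]
      ResidueField (Localization.AtPrime q)) := by
  let A := Localization.AtPrime q
  have h1 := Submodule.localized'_eq_span (S := A) (p := q.primeCompl)
    (f := Algebra.linearMap R A) (M' := q)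
  have h2 : Submodule.localized' A q.primeCompl (Algebra.linearMap R A) q = maximalIdeal A := by
    rw [← Localization.AtPrime.map_eq_maximalIdeal]
    exact h1
  let f := q.toLocalizedQuotient' A q.primeCompl (Algebra.linearMap R A)
  let e := (IsLocalizedModule.linearEquiv q.primeCompl
    (LocalizedModule.mkLinearMap q.primeCompl (R ⧸ q)) f).extendScalarsOfIsLocalization
    q.primeCompl A
  exact ⟨e.trans (Submodule.quotEquivOfEq _ _ h2)⟩

/-- Localizations of regular local rings at prime ideals are regular. -/
theorem IsRegularLocalRing.localization_atPrime {R : Type u} [CommRing R] [IsRegularLocalRing R]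
    (q : Ideal R) [q.IsPrime] : IsRegularLocalRing (Localization.AtPrime q) := by
  obtain ⟨n, hn⟩ := exists_projDimLE (R := R) (R ⧸ q)
  obtain ⟨e⟩ := nonempty_localizedModule_quotient_equiv_residueField q
  have := IsLocalization.isNoetherianRing q.primeCompl (Localization.AtPrime q) inferInstance
  exact .of_projDimLE_residueField ((hn.localizedModule q.primeCompl).of_equiv e)

/-! ### Stably free modules and ideals -/

namespace Module

theorem IsStablyFree.of_prod_equiv_free {S : Type*} [CommRing S] {K M F : Type*} [AddCommGroup K]
    [Module S K] [AddCommGroup M] [Module S M] [AddCommGroup F] [Module S F] [Module.Free S F]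
    [Module.Finite S K] [IsStablyFree S K] (e : F ≃ₗ[S] K × M) : IsStablyFree S M := by
  obtain ⟨N, _, _, _, _, _⟩ := IsStablyFree.exist_free_prod S K
  have : Module.Free S (M × (K × N)) := Module.Free.of_equiv
    ((e.prodCongr (LinearEquiv.refl S N)).trans
      (((LinearEquiv.prodComm S K M).prodCongr (LinearEquiv.refl S N)).trans
        (LinearEquiv.prodAssoc S M K N)))
  exact .of_free_prod S M (K × N)

/-- Let `M` be a finitely generated module of finite projective dimension over a Noetherian local
ring. If a localization of `M` is projective, then it is stably free. -/
theorem ProjDimLE.isStablyFree_localizedModule {R : Type u} [CommRing R] [IsLocalRing R]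
    [IsNoetherianRing R] {M : Type u} [AddCommGroup M] [Module R M] [Module.Finite R M] {n : ℕ}
    (h : ProjDimLE R M n) (S : Submonoid R)
    [Module.Projective (Localization S) (LocalizedModule S M)] :
    IsStablyFree (Localization S) (LocalizedModule S M) := by
  induction n generalizing M with
  | zero =>
    rw [projDimLE_zero_iff] at h
    have : Module.Free R M := Module.free_of_flat_of_isLocalRing
    have : Module.Free (Localization S) (LocalizedModule S M) :=
      Module.free_of_isLocalizedModule S (LocalizedModule.mkLinearMap S M)
    infer_instance
  | succ n ih =>
    obtain ⟨m, f, hf⟩ := Module.Finite.exists_fin' R M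
    have hK := (projDimLE_succ_iff_ker hf n).mp h
    have hex := LocalizedModule.map_exact S (LinearMap.ker f).subtype f
      (LinearMap.exact_subtype_ker_map f)
    have hinj := LocalizedModule.map_injective S (LinearMap.ker f).subtype Subtype.val_injective
    have hsurj := LocalizedModule.map_surjective S f hf
    -- The localized presentation splits, so the localized syzygy is projective too and the
    -- induction continues.
    obtain ⟨l, hl⟩ := Module.projective_lifting_property (LocalizedModule.map S f) LinearMap.id
      hsurj
    obtain ⟨e, -, -⟩ := Function.Exact.splitSurjectiveEquiv (R := Localization S)
      (M := LocalizedModule S (LinearMap.ker f)) (N := LocalizedModule S (Fin m → R))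
      (P := LocalizedModule S M)
      (f := LocalizedModule.map S (LinearMap.ker f).subtype) (g := LocalizedModule.map S f)
      hex hinj ⟨l, hl⟩
    have : Module.Free (Localization S) (LocalizedModule S (Fin m → R)) :=
      Module.free_of_isLocalizedModule S (LocalizedModule.mkLinearMap S (Fin m → R))
    have : Module.Projective (Localization S) (LocalizedModule S (LinearMap.ker f)) :=
      .of_split (e.symm.toLinearMap ∘ₗ LinearMap.inl _ _ _)
        (LinearMap.fst _ _ _ ∘ₗ e.toLinearMap) (by ext; simp)
    have := ih hK
    exact .of_prod_equiv_free e

end Module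

namespace Ideal

/-- An ideal `I` of `S` such that `I × Sⁿ` is free of rank `n + 1` is principal. -/
theorem isPrincipal_of_prod_equiv {S : Type*} [CommRing S] (I : Ideal S) {n : ℕ}
    (e : (I × (Fin n → S)) ≃ₗ[S] (Fin (n + 1) → S)) : I.IsPrincipal := by
  let cons : (S × (Fin n → S)) ≃ₗ[S] (Fin (n + 1) → S) := Fin.consLinearEquiv S (fun _ ↦ S)
  let B : (Fin (n + 1) → S) →ₗ[S] (Fin (n + 1) → S) := cons.toLinearMap ∘ₗ
    (I.subtype.prodMap LinearMap.id) ∘ₗ e.symm.toLinearMap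
  -- `B` comes from I ⊆ S and `C a` from multiplication by a; `B ∘ C a` is diag(a, 1, …, 1), so det
  -- `B` divides every a ∈ I.
  let C (a : I) : (Fin (n + 1) → S) →ₗ[S] (Fin (n + 1) → S) := e.toLinearMap ∘ₗ
    ((LinearMap.toSpanSingleton S I a).prodMap LinearMap.id) ∘ₗ cons.symm.toLinearMap
  have hBC (a : I) : LinearMap.det B * LinearMap.det (C a) = a := by
    rw [← LinearMap.det_comp]
    have : B ∘ₗ C a = Matrix.toLin' (Matrix.diagonal (Fin.cons (a : S) fun _ ↦ 1)) := by
      refine LinearMap.ext fun v ↦ funext fun i ↦ ?_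
      refine Fin.cases ?_ (fun i ↦ ?_) i <;>
        simp [B, C, cons, Matrix.mulVec_diagonal, Fin.consLinearEquiv, Fin.tail, mul_comm]
    rw [this, LinearMap.det_toLin', Matrix.det_diagonal, Fin.prod_univ_succ]
    simp
  have hB : LinearMap.det B ∈ I := by
    -- Row zero of `B` has its entries in I.
    rw [← LinearMap.det_toMatrix', Matrix.det_succ_row_zero]
    refine Ideal.sum_mem _ fun j _ ↦ I.mul_mem_right _ (I.mul_mem_left _ ?_)
    simp [LinearMap.toMatrix'_apply, B, cons, Fin.consLinearEquiv]
  refine ⟨LinearMap.det B, le_antisymm (fun a ha ↦ ?_) ?_⟩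
  · exact Ideal.mem_span_singleton.mpr ⟨_, (hBC ⟨a, ha⟩).symm⟩
  · exact (Ideal.span_singleton_le_iff_mem _).mpr hB

/-- A nonzero a ∈ I embeds S in I, and I embeds in S; comparing ranks after adding N puts I in the
form of the determinant argument. -/
theorem isPrincipal_of_isStablyFree {S : Type*} [CommRing S] [IsDomain S] (I : Ideal S)
    [IsNoetherianRing S] [Module.IsStablyFree S I] : I.IsPrincipal := by
  by_cases hI : I = ⊥
  · exact hI ▸ bot_isPrincipal
  obtain ⟨a, ha, ha0⟩ := Submodule.exists_mem_ne_zero_of_ne_bot hI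
  obtain ⟨N, _, _, _, _, _⟩ := Module.IsStablyFree.exist_free_prod S I
  have h1 : Module.finrank S (S × N) ≤ Module.finrank S (I × N) := by
    refine LinearMap.finrank_le_finrank_of_injective
      (f := (LinearMap.toSpanSingleton S I ⟨a, ha⟩).prodMap LinearMap.id) ?_
    rw [LinearMap.coe_prodMap]
    refine Function.Injective.prodMap ?_ Function.injective_id
    rw [injective_iff_map_eq_zero]
    intro c hc
    simpa [ha0] using congrArg Subtype.val hc
  have h2 : Module.finrank S (I × N) ≤ Module.finrank S (S × N) := by
    refine LinearMap.finrank_le_finrank_of_injective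
      (f := I.subtype.prodMap LinearMap.id) ?_
    rw [LinearMap.coe_prodMap]
    exact Subtype.val_injective.prodMap Function.injective_id
  have h3 : Module.finrank S (I × N) = Module.finrank S N + 1 := by
    rw [le_antisymm h2 h1, Module.finrank_prod, Module.finrank_self, add_comm]
  exact isPrincipal_of_prod_equiv I
    (((LinearEquiv.refl S I).prodCongr (Module.finBasis S N).equivFun.symm).trans
      (Module.finBasisOfFinrankEq S (I × N) h3).equivFun)

end Ideal

/-! ### Locally principal ideals and unique factorization -/

/-- The localization of an ideal as a module is the extended ideal. -/
noncomputable def LocalizedModule.idealEquiv {R : Type*} [CommRing R] (S : Submonoid R)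
    (A : Type*) [CommRing A] [Algebra R A] [IsLocalization S A] (I : Ideal R) :
    LocalizedModule S I ≃ₗ[R] I.map (algebraMap R A) :=
  IsLocalizedModule.linearEquiv S (LocalizedModule.mkLinearMap S I) (Algebra.idealMap A I)

/-- An ideal of a Noetherian domain that becomes principal in each localization at a maximal ideal
is projective. -/
theorem Ideal.projective_of_localization_maximal {A : Type*} [CommRing A] [IsDomain A]
    [IsNoetherianRing A] (I : Ideal A)
    (h : ∀ (Q : Ideal A) [Q.IsMaximal],
      (I.map (algebraMap A (Localization.AtPrime Q))).IsPrincipal) : Module.Projective A I := by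
  have := Module.finitePresentation_of_finite A I
  refine Module.projective_of_localization_maximal fun Q hQ ↦ ?_
  have : Module.Free (Localization.AtPrime Q) (I.map (algebraMap A (Localization.AtPrime Q))) := by
    obtain ⟨g, hg⟩ := h Q
    by_cases hg0 : g = 0
    · have : Subsingleton (I.map (algebraMap A (Localization.AtPrime Q))) := by
        rw [hg, hg0]
        simp
        infer_instance
      infer_instance
    · rw [hg]
      exact Module.Free.of_equiv (LinearEquiv.toSpanNonzeroSingleton _ _ g hg0)
  exact Module.Projective.of_equiv ((LocalizedModule.idealEquiv Q.primeCompl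
    (Localization.AtPrime Q) I).extendScalarsOfIsLocalization Q.primeCompl
      (Localization.AtPrime Q)).symm

namespace IsRegularLocalRing

theorem spanFinrank_maximalIdeal_localization_lt {R : Type u} [CommRing R] [IsRegularLocalRing R]
    (q : Ideal R) [q.IsPrime] (hq : q ≠ maximalIdeal R) :
    (maximalIdeal (Localization.AtPrime q)).spanFinrank < (maximalIdeal R).spanFinrank := by
  have := localization_atPrime q
  have hlt : q < maximalIdeal R := (IsLocalRing.le_maximalIdeal (Ideal.IsPrime.ne_top')).lt_of_ne hq
  have h1 := Ideal.height_add_one_le_of_lt_of_isPrime hlt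
  have h2 : ((q.height + 1 : ℕ∞) : WithBot ℕ∞) ≤ ((maximalIdeal R).height : ℕ∞) :=
    WithBot.coe_le_coe.mpr h1
  rw [maximalIdeal_height_eq_ringKrullDim, WithBot.coe_add,
    ← IsLocalization.AtPrime.ringKrullDim_eq_height q (Localization.AtPrime q),
    ← spanFinrank_maximalIdeal, ← spanFinrank_maximalIdeal] at h2
  exact_mod_cast h2

/-- Regular local rings are unique factorization domains (the theorem of Auslander and Buchsbaum). -/
theorem uniqueFactorizationMonoid {R : Type u} [CommRing R] [IsDomain R] [IsRegularLocalRing R] :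
    UniqueFactorizationMonoid R := by
  induction hd : (maximalIdeal R).spanFinrank using Nat.strong_induction_on generalizing R with
  | h d ih =>
  by_cases hm : maximalIdeal R = ⊥
  · let := (IsLocalRing.isField_iff_maximalIdeal_eq.mpr hm).toField
    infer_instance
  obtain ⟨x, hx, hx2⟩ := exists_mem_maximalIdeal_notMem_sq' hm
  have hx0 : x ≠ 0 := by rintro rfl; exact hx2 (zero_mem _)
  have hprime : Prime x := by
    have := quotient_span_singleton hx hx2
    rw [← Ideal.span_singleton_prime hx0]
    exact (Ideal.Quotient.isDomain_iff_prime _).mp isDomain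
  rw [UniqueFactorizationMonoid.iff_localizationAway_of_prime hprime]
  let A := Localization.Away x
  have : IsDomain A := IsLocalization.Away.isDomain A hx0
  have : IsNoetherianRing A := IsLocalization.isNoetherianRing (.powers x) A inferInstance
  refine .of_forall_isPrincipal_of_height_eq_one fun P hP hP1 ↦ ?_
  have hloc : Module.Projective A P := by
    refine Ideal.projective_of_localization_maximal P fun Q hQ ↦ ?_
    let q := Q.under R
    have hq : q ≠ maximalIdeal R := by
      intro h
      refine hQ.ne_top (Ideal.eq_top_of_isUnit_mem Q (x := algebraMap R A x) ?_
        (IsLocalization.Away.algebraMap_isUnit x))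
      have : x ∈ q := h ▸ hx
      exact this
    -- A_Q is R_q with q ≠ 𝔪, so the induction hypothesis makes it factorial.
    have hAt : IsLocalization.AtPrime (Localization.AtPrime Q) q :=
      IsLocalization.isLocalization_isLocalization_atPrime_isLocalization (.powers x)
        (Localization.AtPrime Q) Q
    let e := (IsLocalization.algEquiv q.primeCompl (Localization.AtPrime q)
      (Localization.AtPrime Q)).toRingEquiv
    have := localization_atPrime q
    have : IsDomain (Localization.AtPrime q) := isDomain
    have hufd := ih _ (hd ▸ spanFinrank_maximalIdeal_localization_lt q hq)
      (R := Localization.AtPrime q) rfl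
    have : UniqueFactorizationMonoid (Localization.AtPrime Q) :=
      e.toMulEquiv.uniqueFactorizationMonoid hufd
    by_cases hPQ : P ≤ Q
    · have hdisj : Disjoint (Q.primeCompl : Set A) (P : Set A) :=
        Set.disjoint_left.mpr fun a ha haP ↦ ha (hPQ haP)
      have := IsLocalization.isPrime_of_isPrime_disjoint Q.primeCompl (Localization.AtPrime Q) P hP
        hdisj
      refine UniqueFactorizationMonoid.isPrincipal_of_height_eq_one ?_
      rw [IsLocalization.height_map_of_disjoint Q.primeCompl P hdisj, hP1]
    · obtain ⟨a, haP, haQ⟩ := SetLike.not_le_iff_exists.mp hPQ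
      rw [Ideal.eq_top_of_isUnit_mem _ (Ideal.mem_map_of_mem _ haP)
        (IsLocalization.map_units (Localization.AtPrime Q) (⟨a, haQ⟩ : Q.primeCompl))]
      exact ⟨1, by simp⟩
  let p := P.under R
  have hmap : p.map (algebraMap R A) = P := IsLocalization.map_under (.powers x) A P
  obtain ⟨n, hn⟩ := exists_projDimLE (R := R) p
  let e : LocalizedModule (.powers x) p ≃ₗ[A] P :=
    ((LocalizedModule.idealEquiv (.powers x) A p).extendScalarsOfIsLocalization (.powers x) A).trans
      (LinearEquiv.ofEq _ _ hmap)
  have : Module.Projective A (LocalizedModule (.powers x) p) := .of_equiv e.symm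
  -- A finite resolution exists over the local ring R, hence the passage from P to its contraction
  -- p.
  have := hn.isStablyFree_localizedModule (.powers x)
  have : Module.IsStablyFree A P := Module.IsStablyFree.equiv e
  exact P.isPrincipal_of_isStablyFree

end IsRegularLocalRing

/-! ### Generators of a principal ideal and the conclusion -/

/-- In a local domain, a generating family of a nonzero principal ideal contains an associate of
each generator. -/
theorem IsLocalRing.exists_eq_mul_unit_of_span_range_eq {R : Type*} [CommRing R] [IsDomain R]
    [IsLocalRing R] {ι : Type*} (t : ι → R) {s : R} (hs : s ≠ 0)
    (h : Ideal.span (Set.range t) = Ideal.span {s}) : ∃ (i : ι) (u : Rˣ), t i = s * u := by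
  have hdvd : ∀ i, s ∣ t i := fun i ↦
    Ideal.mem_span_singleton.mp (h ▸ Ideal.subset_span (Set.mem_range_self i))
  choose c hc using hdvd
  by_contra! hne
  have hcm : ∀ i, c i ∈ maximalIdeal R := fun i hu ↦ hne i hu.unit (hc i)
  have hle : Ideal.span {s} ≤ Ideal.span {s} * maximalIdeal R := by
    conv_lhs => rw [← h]
    rw [Ideal.span_le]
    rintro _ ⟨i, rfl⟩
    rw [hc i]
    exact Ideal.mul_mem_mul (Ideal.mem_span_singleton_self s) (hcm i)
  obtain ⟨a, ha, has⟩ := Ideal.mem_span_singleton_mul.mp (hle (Ideal.mem_span_singleton_self s))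
  have ha1 : a = 1 := mul_left_cancel₀ hs (by rw [has, mul_one])
  exact (Ideal.ne_top_iff_one _).mp (Ideal.IsPrime.ne_top' (I := maximalIdeal R)) (ha1 ▸ ha)

theorem mainTheorem4 {R : Type*} [CommRing R] [IsRegularLocalRing R] {r : ℕ} (t : Fin r → R)
    (hprime : (Ideal.span (Set.range t)).IsPrime)
    (hheight : (Ideal.span (Set.range t)).height = 1) :
    (∃ s : R, Ideal.span (Set.range t) = Ideal.span {s}) ∧
    (∀ s : R, Ideal.span (Set.range t) = Ideal.span {s} → ∃ (i : Fin r) (u : Rˣ), t i = s * u) ∧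
    (∃ i : Fin r, Ideal.span (Set.range t) = Ideal.span {t i}) := by
  have : IsDomain R := IsRegularLocalRing.isDomain
  have : UniqueFactorizationMonoid R := IsRegularLocalRing.uniqueFactorizationMonoid
  have hne := Ideal.ne_bot_of_height_eq_one hheight
  obtain ⟨s, hs⟩ := UniqueFactorizationMonoid.isPrincipal_of_height_eq_one hheight
  have key : ∀ s : R, Ideal.span (Set.range t) = Ideal.span {s} →
      ∃ (i : Fin r) (u : Rˣ), t i = s * u := fun s hs ↦
    exists_eq_mul_unit_of_span_range_eq t (by rintro rfl; exact hne (by simpa using hs)) hs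
  refine ⟨⟨s, hs⟩, key, ?_⟩
  obtain ⟨i, u, hi⟩ := key s hs
  refine ⟨i, ?_⟩
  rw [hi, Ideal.span_singleton_mul_right_unit u.isUnit]
  exact hs
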